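/- Let $G\subset\mathbb{C}$ be a domain (a non-empty connected open set) and let $F\subset G$ be relatively closed in $G$. For a relatively closed set $E\subset G$, a $G$-hole of $E$ is a (non-empty) connected component of $G\setminus E$ that is contained in some compact subset of $G$. Let $G^*=G\cup\{\infty\}$ be the one-point (Alexandroff) compactification of $G$. Then the following two conditions on $F$ are equivalent. (A) $F$ has no $G$-holes, and for every connected compact set $K\subset G$ whose boundary $\partial K$ is the union of finitely many pairwise disjoint Jordan curves, the union of all $G$-holes of $F\cup K$ is contained in a compact subset of $G$. (B) The subspace $G^*\setminus F$ of $G^*$ is connected, and it is locally connected at $\infty$, that is, every open subset of $G^*\setminus F$ that contains $\infty$ contains a connected open subset of $G^*\setminus F$ that contains $\infty$. -/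

import Mathlib

open Set Topology

/-- A Jordan curve in the plane: the image of the circle under a continuous injective map. -/
def IsJordanCurve (J : Set ℂ) : Prop :=
  ∃ γ : Circle → ℂ, Continuous γ ∧ Function.Injective γ ∧ range γ = J

/-- The boundary of `K` is the union of (finitely many) pairwise disjoint Jordan curves.
For compact `K`, finiteness of the family amounts to asking that every point of the boundary
has a neighbourhood in the boundary that is homeomorphic to an open interval. -/
def HasJordanBoundary (K : Set ℂ) : Prop :=
  ∃ 𝒥 : Set (Set ℂ), 𝒥.Finite ∧ (∀ J ∈ 𝒥, IsJordanCurve J) ∧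
    𝒥.PairwiseDisjoint id ∧ frontier K = ⋃₀ 𝒥

/-- `S` can be enclosed in a compact subset of `G`. -/
def CompactlyEnclosed (G S : Set ℂ) : Prop :=
  ∃ L : Set ℂ, IsCompact L ∧ L ⊆ G ∧ S ⊆ L

/-- `h` is a `G`-hole of `F`: a connected component of `G \ F` that can be enclosed in a
compact subset of `G`. -/
def IsGHole (G F h : Set ℂ) : Prop :=
  (∃ z ∈ G \ F, h = connectedComponentIn (G \ F) z) ∧ CompactlyEnclosed G h

/-- Arakeljan sets, defined through `G`-holes. -/
def IsArakeljanSet (G F : Set ℂ) : Prop :=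
  (∀ h : Set ℂ, ¬ IsGHole G F h) ∧
  ∀ K : Set ℂ, IsCompact K → IsConnected K → K ⊆ G → HasJordanBoundary K →
    CompactlyEnclosed G (⋃₀ {h : Set ℂ | IsGHole G (F ∪ K) h})

/-- `X` is locally connected at the point `x`: every open set containing `x` contains a
connected open set containing `x`. -/
def LocallyConnectedAt {X : Type*} [TopologicalSpace X] (x : X) : Prop :=
  ∀ U : Set X, IsOpen U → x ∈ U → ∃ V : Set X, V ⊆ U ∧ IsOpen V ∧ x ∈ V ∧ IsConnected V

/-- The subset `G* \ F` of the one-point compactification `G* = G ∪ {∞}` of `G`. -/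
def starDiff (G F : Set ℂ) : Set (OnePoint G) :=
  ((fun z : G => (z : OnePoint G)) '' {z : G | (z : ℂ) ∈ F})ᶜ

theorem infty_mem_starDiff (G F : Set ℂ) : (OnePoint.infty : OnePoint G) ∈ starDiff G F := by
  rintro ⟨z, -, hz⟩
  exact OnePoint.coe_ne_infty z hz

/-- Arakeljan sets, defined topologically: `G* \ F` is connected, and (as a space with the
subspace topology) it is locally connected at `∞`. -/
def IsTopologicalArakeljanSet (G F : Set ℂ) : Prop :=
  IsConnected (starDiff G F) ∧
  LocallyConnectedAt (⟨OnePoint.infty, infty_mem_starDiff G F⟩ : starDiff G F)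

/-! A component of `G \ E` escapes every compact subset of `G` exactly when `∞` lies in its closure
in `G*`. So the escaping components together with `∞` form a connected set
(`isConnected_insert_infty_unenclosedPart`), while a hole is clopen in `G* \ E` and misses every
connected set through `∞` (`disjoint_starLift_of_isGHole`).

From (B) to (A): a connected neighbourhood of `∞` in `G* \ F` that avoids `K` misses all holes of `F
∪ K`, and what it omits is controlled by a compact set. From (A) to (B): given a neighbourhood of
`∞`, take an admissible `K` containing the compact set that it omits. The escaping components of `G
\ (F ∪ K)` together with `∞` are connected; they form a neighbourhood of `∞` because the holes of `F
∪ K` stay in a compact set.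

This needs every compact `C ⊆ G` to lie in an admissible `K` (`exists_hasJordanBoundary_superset`).
Enlarge `C` to a connected compact set and take all bricks of a fine brick tiling that meet it. At
most three bricks meet at a point, so the boundary edges never cross or touch at a vertex and close
up into disjoint Jordan polygons. -/

/-- The copy in `G* = G ∪ {∞}` of a plane set. -/
def starLift (G W : Set ℂ) : Set (OnePoint G) :=
  (fun z : G => (z : OnePoint G)) '' {z : G | (z : ℂ) ∈ W}

theorem coe_mem_starLift {G W : Set ℂ} {z : G} :
    (z : OnePoint G) ∈ starLift G W ↔ (z : ℂ) ∈ W := by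
  simp [starLift]

theorem starLift_mono {G W W' : Set ℂ} (h : W ⊆ W') : starLift G W ⊆ starLift G W' :=
  image_mono fun _ hz => h hz

theorem infty_notMem_starLift (G W : Set ℂ) : (OnePoint.infty : OnePoint G) ∉ starLift G W := by
  rintro ⟨z, -, hz⟩
  exact OnePoint.coe_ne_infty z hz

theorem coe_mem_starDiff {G F : Set ℂ} {z : G} :
    (z : OnePoint G) ∈ starDiff G F ↔ (z : ℂ) ∉ F :=
  not_congr coe_mem_starLift

theorem isOpen_starLift {G W : Set ℂ} (hW : IsOpen W) : IsOpen (starLift G W) :=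
  OnePoint.isOpenEmbedding_coe.isOpenMap _ (hW.preimage continuous_subtype_val)

theorem isCompact_preimage_val {G L : Set ℂ} (hL : IsCompact L) (hLG : L ⊆ G) :
    IsCompact {z : G | (z : ℂ) ∈ L} := by
  refine Topology.IsInducing.subtypeVal.isCompact_iff.2 ?_
  have : ((↑) : G → ℂ) '' {z : G | (z : ℂ) ∈ L} = L :=
    Subtype.image_preimage_coe G L |>.trans (inter_eq_right.2 hLG)
  rwa [this]

theorem isClosed_starLift {G L : Set ℂ} (hL : IsCompact L) (hLG : L ⊆ G) :
    IsClosed (starLift G L) := by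
  have h := isCompact_preimage_val hL hLG
  exact OnePoint.isClosed_image_coe.2 ⟨h.isClosed, h⟩

/-- A neighbourhood of `∞` missing `W` would have a compact complement in `G` enclosing `W`. Hence
`∞` is a limit point of `W`, and adding limit points preserves connectedness. -/
theorem isConnected_insert_infty_starLift {G W : Set ℂ} (hWG : W ⊆ G) (hW : IsPreconnected W)
    (hne : ¬ CompactlyEnclosed G W) : IsConnected (insert OnePoint.infty (starLift G W)) := by
  refine ⟨⟨_, mem_insert _ _⟩, ?_⟩
  have h1 : IsPreconnected (starLift G W) := by
    refine IsPreconnected.image ?_ _ OnePoint.continuous_coe.continuousOn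
    refine Topology.IsInducing.subtypeVal.isPreconnected_image.1 ?_
    have : ((↑) : G → ℂ) '' {z : G | (z : ℂ) ∈ W} = W :=
      Subtype.image_preimage_coe G W |>.trans (inter_eq_right.2 hWG)
    rwa [this]
  refine h1.subset_closure (subset_insert _ _) (insert_subset ?_ subset_closure)
  rw [mem_closure_iff]
  intro o ho hmem
  by_contra hemp
  rw [OnePoint.isOpen_iff_of_mem hmem] at ho
  refine hne ⟨_, ho.2.image continuous_subtype_val, Subtype.coe_image_subset _ _, ?_⟩
  intro z hz
  refine ⟨⟨z, hWG hz⟩, fun hzo => hemp ⟨_, hzo, ?_⟩, rfl⟩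
  exact coe_mem_starLift.2 hz

/-! ### Holes, escaping components and connected sets through `∞` -/

/-- The part of `G \ E` outside all `G`-holes of `E`. -/
def unenclosedPart (G E : Set ℂ) : Set ℂ :=
  {z | z ∈ G \ E ∧ ¬ CompactlyEnclosed G (connectedComponentIn (G \ E) z)}

theorem connectedComponentIn_subset_unenclosedPart {G E : Set ℂ} {z : ℂ}
    (hz : z ∈ unenclosedPart G E) :
    connectedComponentIn (G \ E) z ⊆ unenclosedPart G E := fun w hw =>
  ⟨connectedComponentIn_subset _ _ hw, by
    rw [← connectedComponentIn_eq hw]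
    exact hz.2⟩

theorem isOpen_unenclosedPart {G E : Set ℂ} (hE : IsOpen (G \ E)) :
    IsOpen (unenclosedPart G E) := by
  refine isOpen_iff_mem_nhds.2 fun z hz => ?_
  exact Filter.mem_of_superset
    (hE.connectedComponentIn.mem_nhds (mem_connectedComponentIn hz.1))
    (connectedComponentIn_subset_unenclosedPart hz)

theorem isConnected_insert_infty_unenclosedPart (G E : Set ℂ) :
    IsConnected (insert OnePoint.infty (starLift G (unenclosedPart G E))) := by
  refine ⟨⟨_, mem_insert _ _⟩, isPreconnected_of_forall OnePoint.infty ?_⟩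
  rintro y (rfl | ⟨z, hz, rfl⟩)
  · exact ⟨{OnePoint.infty}, by simp, rfl, rfl, isPreconnected_singleton⟩
  · have hz' : (z : ℂ) ∈ unenclosedPart G E := hz
    refine ⟨_, insert_subset_insert
      (starLift_mono (connectedComponentIn_subset_unenclosedPart hz')), mem_insert _ _,
      mem_insert_of_mem _ (coe_mem_starLift.2 (mem_connectedComponentIn hz'.1)),
      (isConnected_insert_infty_starLift
        ((connectedComponentIn_subset _ _).trans sdiff_subset)
        isPreconnected_connectedComponentIn hz'.2).isPreconnected⟩

/-- The hole is open, and its closure is compact in `G`, hence closed in `G*`. A point of that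
closure outside `E` has a component meeting the hole, so it lies in the hole. Thus the hole is
clopen in `G* \ E` and omits `∞`. -/
theorem disjoint_starLift_of_isGHole {G E h : Set ℂ} (hE : IsOpen (G \ E)) (hh : IsGHole G E h)
    {V : Set (OnePoint G)} (hV : IsPreconnected V) (hVE : V ⊆ starDiff G E)
    (hinf : OnePoint.infty ∈ V) : Disjoint V (starLift G h) := by
  obtain ⟨⟨a, ha, rfl⟩, L, hL, hLG, hhL⟩ := hh
  set h := connectedComponentIn (G \ E) a
  have hcl : closure h ⊆ L := closure_minimal hhL hL.isClosed
  have hcc : IsCompact (closure h) := hL.of_isClosed_subset isClosed_closure hcl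
  rw [Set.disjoint_iff_inter_eq_empty]
  by_contra hne
  obtain ⟨y, -, hy1, hy2⟩ := hV (starLift G h) (starLift G (closure h))ᶜ
    (isOpen_starLift hE.connectedComponentIn)
    (isClosed_starLift hcc (hcl.trans hLG)).isOpen_compl (by
      intro y hy
      by_cases hyc : y ∈ starLift G (closure h)
      · left
        obtain ⟨z, hz, rfl⟩ := hyc
        have hzE : (z : ℂ) ∈ G \ E := ⟨z.2, coe_mem_starDiff.1 (hVE hy)⟩
        obtain ⟨w, hw1, hw2⟩ := mem_closure_iff.1 hz _ hE.connectedComponentIn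
          (mem_connectedComponentIn hzE)
        refine coe_mem_starLift.2 ?_
        have : h = connectedComponentIn (G \ E) z :=
          (connectedComponentIn_eq hw2).trans (connectedComponentIn_eq hw1).symm
        rw [this]
        exact mem_connectedComponentIn hzE
      · exact Or.inr hyc)
    (nonempty_iff_ne_empty.2 hne)
    ⟨_, hinf, infty_notMem_starLift _ _⟩
  exact hy2 (starLift_mono subset_closure hy1)

/-! ### The two implications, given an exhaustion -/

theorem IsTopologicalArakeljanSet.isArakeljanSet {G F : Set ℂ}
    (hF : IsOpen (G \ F)) (h : IsTopologicalArakeljanSet G F) : IsArakeljanSet G F := by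
  obtain ⟨hconn, hloc⟩ := h
  refine ⟨fun h hh => ?_, fun K hK _ hKG _ => ?_⟩
  · have hd := disjoint_starLift_of_isGHole hF hh hconn.isPreconnected subset_rfl
      (infty_mem_starDiff G F)
    obtain ⟨⟨a, ha, rfl⟩, -⟩ := hh
    exact disjoint_left.1 hd (coe_mem_starDiff.2 ha.2 : ((⟨a, ha.1⟩ : G) : OnePoint G) ∈ _)
      (coe_mem_starLift.2 (mem_connectedComponentIn ha))
  · obtain ⟨V, hVU, hVo, hVinf, hVc⟩ := hloc {x | (x : OnePoint G) ∉ starLift G K}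
      ((isClosed_starLift hK hKG).isOpen_compl.preimage continuous_subtype_val)
      (infty_notMem_starLift G K)
    obtain ⟨O, hO, rfl⟩ := isOpen_induced_iff.1 hVo
    have hinfO : OnePoint.infty ∈ O := hVinf
    rw [OnePoint.isOpen_iff_of_mem hinfO] at hO
    refine ⟨_, hO.2.image continuous_subtype_val, Subtype.coe_image_subset _ _, ?_⟩
    have hFK : IsOpen (G \ (F ∪ K)) := by
      rw [← sdiff_sdiff]
      exact hF.sdiff hK.isClosed
    rintro z ⟨h, hh, hz⟩
    have hzE : z ∈ G \ (F ∪ K) := by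
      obtain ⟨⟨a, ha, rfl⟩, -⟩ := hh
      exact connectedComponentIn_subset _ _ hz
    have hd := disjoint_starLift_of_isGHole hFK hh
      (hVc.isPreconnected.image _ continuous_subtype_val.continuousOn) (by
        rintro _ ⟨x, hx, rfl⟩ ⟨w, hw | hw, hwx⟩
        · exact x.2 ⟨w, hw, hwx⟩
        · exact hVU hx ⟨w, hw, hwx⟩) ⟨_, hVinf, rfl⟩
    refine ⟨⟨z, hzE.1⟩, fun hzO => ?_, rfl⟩
    refine disjoint_left.1 hd ⟨⟨_, coe_mem_starDiff.2 fun hzF => hzE.2 (Or.inl hzF)⟩, hzO, rfl⟩ ?_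
    exact coe_mem_starLift.2 hz

theorem starDiff_eq_insert_infty (G F : Set ℂ) :
    starDiff G F = insert OnePoint.infty (starLift G (G \ F)) := by
  ext x
  induction x using OnePoint.rec with
  | infty => simp [infty_mem_starDiff]
  | coe z => simp [coe_mem_starDiff, coe_mem_starLift]

theorem IsArakeljanSet.isTopologicalArakeljanSet {G F : Set ℂ}
    (hF : IsOpen (G \ F))
    (exhaust : ∀ C ⊆ G, IsCompact C → ∃ K, IsCompact K ∧ IsConnected K ∧ K ⊆ G ∧
      HasJordanBoundary K ∧ C ⊆ K)
    (h : IsArakeljanSet G F) : IsTopologicalArakeljanSet G F := by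
  obtain ⟨hno, hen⟩ := h
  constructor
  · have : G \ F = unenclosedPart G F :=
      subset_antisymm (fun z hz => ⟨hz, fun hc => hno _ ⟨⟨z, hz, rfl⟩, hc⟩⟩) fun z hz => hz.1
    rw [starDiff_eq_insert_infty, this]
    exact isConnected_insert_infty_unenclosedPart G F
  · intro U hU hinf
    obtain ⟨O, hO, rfl⟩ := isOpen_induced_iff.1 hU
    have hinfO : OnePoint.infty ∈ O := hinf
    rw [OnePoint.isOpen_iff_of_mem hinfO] at hO
    obtain ⟨K, hK, hKc, hKG, hKJ, hCK⟩ := exhaust _ (Subtype.coe_image_subset _ _)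
      (hO.2.image continuous_subtype_val)
    obtain ⟨L, hL, hLG, hHL⟩ := hen K hK hKc hKG hKJ
    have hFK : IsOpen (G \ (F ∪ K)) := by
      rw [← sdiff_sdiff]
      exact hF.sdiff hK.isClosed
    have hKL := isClosed_starLift (hK.union hL) (union_subset hKG hLG)
    -- Two descriptions of the neighbourhood: the left one shows that it is open, the right one that
    -- it is connected. They agree because `L` contains all holes of `F ∪ K`.
    have hV : ((↑) : starDiff G F → OnePoint G) ⁻¹'
          (starLift G (unenclosedPart G (F ∪ K)) ∪ (starLift G (K ∪ L))ᶜ) =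
        (↑) ⁻¹' (insert OnePoint.infty (starLift G (unenclosedPart G (F ∪ K)))) := by
      ext ⟨x, hx⟩
      induction x using OnePoint.rec with
      | infty => simp [infty_notMem_starLift]
      | coe z =>
        simp only [mem_preimage, mem_union, mem_compl_iff, mem_insert_iff,
          OnePoint.coe_ne_infty, false_or, coe_mem_starLift, or_iff_left_iff_imp, not_or]
        rintro ⟨hzK, hzL⟩
        have hz : (z : ℂ) ∈ G \ (F ∪ K) :=
          ⟨z.2, fun h => h.elim (coe_mem_starDiff.1 hx) hzK⟩
        exact ⟨hz, fun hc => hzL (hHL ⟨_, ⟨⟨z, hz, rfl⟩, hc⟩, mem_connectedComponentIn hz⟩)⟩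
    refine ⟨(↑) ⁻¹' (insert OnePoint.infty (starLift G (unenclosedPart G (F ∪ K)))), ?_,
      hV ▸ ((isOpen_starLift (isOpen_unenclosedPart hFK)).union
        hKL.isOpen_compl).preimage continuous_subtype_val, mem_insert _ _, ?_⟩
    · rintro ⟨x, hx⟩ (rfl | ⟨z, hz, rfl⟩)
      · exact hinfO
      · by_contra hzO
        exact hz.1.2 (Or.inr (hCK ⟨z, hzO, rfl⟩))
    · refine ⟨⟨⟨_, infty_mem_starDiff G F⟩, mem_insert _ _⟩,
        Topology.IsInducing.subtypeVal.isPreconnected_image.1 ?_⟩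
      rw [Subtype.image_preimage_coe, inter_eq_right.2]
      · exact (isConnected_insert_infty_unenclosedPart G _).isPreconnected
      · rintro x (rfl | ⟨z, hz, rfl⟩)
        · exact infty_mem_starDiff G F
        · exact coe_mem_starDiff.2 fun h => hz.1.2 (Or.inl h)

/-! ### Closed polygons from the cycles of a permutation -/

section PolygonalCycles

variable {B : Type*} (σ : Equiv.Perm B) (p : B → ℂ)

/-- The polygonal line through the points `p (σ ^ k b)`, `k : ℤ`. -/
noncomputable def polyLine (b : B) (x : ℝ) : ℂ :=
  AffineMap.lineMap (p ((σ ^ ⌊x⌋) b)) (p ((σ ^ (⌊x⌋ + 1)) b)) (Int.fract x)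

theorem polyLine_eq_of_mem_Icc (b : B) (n : ℤ) {x : ℝ} (hx : x ∈ Icc (n : ℝ) (n + 1)) :
    polyLine σ p b x = AffineMap.lineMap (p ((σ ^ n) b)) (p ((σ ^ (n + 1)) b)) (x - n) := by
  rcases eq_or_lt_of_le hx.2 with h | h
  · have hfl : ⌊x⌋ = n + 1 := by rw [h]; exact_mod_cast Int.floor_intCast (n + 1)
    have hfr : Int.fract x = 0 := by rw [Int.fract, hfl, h]; push_cast; ring
    rw [polyLine, hfl, hfr, h]
    simp
  · have hfl : ⌊x⌋ = n := Int.floor_eq_iff.2 ⟨hx.1, h⟩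
    rw [polyLine, Int.fract, hfl]

theorem locallyFinite_Icc_intCast : LocallyFinite fun n : ℤ => Icc (n : ℝ) (n + 1) := by
  intro x
  refine ⟨_, Metric.ball_mem_nhds x one_pos, (finite_Icc (⌊x⌋ - 3) (⌊x⌋ + 3)).subset ?_⟩
  rintro n ⟨y, hy1, hy2⟩
  rw [Real.ball_eq_Ioo] at hy2
  have h1 := Int.floor_le x
  have h2 := Int.lt_floor_add_one x
  have h3 := hy1.1
  have h4 := hy1.2
  have h5 := hy2.1
  have h6 := hy2.2
  constructor
  · have : (⌊x⌋ : ℝ) - 3 ≤ n := by linarith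
    exact_mod_cast this
  · have : (n : ℝ) ≤ ⌊x⌋ + 3 := by linarith
    exact_mod_cast this

theorem continuous_polyLine (b : B) : Continuous (polyLine σ p b) := by
  refine locallyFinite_Icc_intCast.continuous ?_ (fun _ => isClosed_Icc) fun n => ?_
  · exact eq_univ_of_forall fun x =>
      mem_iUnion.2 ⟨⌊x⌋, Int.floor_le x, (Int.lt_floor_add_one x).le⟩
  · refine ContinuousOn.congr ?_ fun x hx => polyLine_eq_of_mem_Icc σ p b n hx
    exact (AffineMap.lineMap_continuous.comp (continuous_sub_right _)).continuousOn

theorem polyLine_add_intCast (b : B) (x : ℝ) (k : ℤ) :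
    polyLine σ p b (x + k) = polyLine σ p ((σ ^ k) b) x := by
  simp only [polyLine, Int.floor_add_intCast, Int.fract_add_intCast, ← Equiv.Perm.mul_apply,
    ← zpow_add, add_right_comm]

theorem range_polyLine_zpow (b : B) (k : ℤ) :
    range (polyLine σ p ((σ ^ k) b)) = range (polyLine σ p b) := by
  have : polyLine σ p ((σ ^ k) b) = polyLine σ p b ∘ (· + (k : ℝ)) :=
    funext fun x => (polyLine_add_intCast σ p b x k).symm
  rw [this, (add_right_surjective (k : ℝ)).range_comp]

variable {σ p}

/-- The line has as period the length `n` of the cycle of `b`, so it descends to a circle. Equal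
values force equal fractional parts and equal edges, hence floors congruent modulo `n`. -/
theorem isJordanCurve_range_polyLine [Finite B]
    (hinj : ∀ b b', ∀ t ∈ Ico (0 : ℝ) 1, ∀ t' ∈ Ico (0 : ℝ) 1,
      AffineMap.lineMap (p b) (p (σ b)) t = AffineMap.lineMap (p b') (p (σ b')) t' →
        b = b' ∧ t = t') (b : B) :
    IsJordanCurve (range (polyLine σ p b)) := by
  set n := Function.minimalPeriod (σ • ·) b with hn
  have hdvd : ∀ k : ℤ, (σ ^ k) b = b ↔ (n : ℤ) ∣ k := fun k =>
    MulAction.zpow_smul_eq_iff_minimalPeriod_dvd (a := σ) (b := b) (n := k)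
  -- `minimalPeriod` is `0` for non-periodic points; the finite order of `σ` rules this out.
  have hn0 : n ≠ 0 := by
    intro h0
    have := (hdvd (orderOf σ)).1 (by rw [zpow_natCast, pow_orderOf_eq_one]; rfl)
    rw [h0, Nat.cast_zero, zero_dvd_iff, Nat.cast_eq_zero] at this
    exact (orderOf_pos σ).ne' this
  have hper : Function.Periodic (polyLine σ p b) (n : ℝ) := fun x => by
    have := polyLine_add_intCast σ p b x n
    rwa [(hdvd n).2 dvd_rfl, Int.cast_natCast] at this
  have hn0' : (n : ℝ) ≠ 0 := Nat.cast_ne_zero.2 hn0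
  refine ⟨hper.lift ∘ (AddCircle.homeomorphCircle hn0').symm,
    (Continuous.comp (continuous_quot_lift _ (continuous_polyLine σ p b)) (Homeomorph.continuous _)),
    Function.Injective.comp ?_ (Homeomorph.injective _), ?_⟩
  · intro x y hxy
    induction x using QuotientAddGroup.induction_on with | H x => ?_
    induction y using QuotientAddGroup.induction_on with | H y => ?_
    have hxy' : polyLine σ p b x = polyLine σ p b y := hxy
    simp only [polyLine, add_comm _ (1 : ℤ), zpow_add, zpow_one, Equiv.Perm.mul_apply] at hxy'
    obtain ⟨h1, h2⟩ := hinj _ _ _ ⟨Int.fract_nonneg x, Int.fract_lt_one x⟩ _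
      ⟨Int.fract_nonneg y, Int.fract_lt_one y⟩ hxy'
    have h3 : (σ ^ (⌊y⌋ - ⌊x⌋)) b = b := by
      rw [sub_eq_neg_add, zpow_add, Equiv.Perm.mul_apply, ← h1, ← Equiv.Perm.mul_apply, ← zpow_add]
      simp
    obtain ⟨m, hm⟩ := (hdvd _).1 h3
    refine QuotientAddGroup.eq.2 ⟨m, ?_⟩
    have hm' : (⌊y⌋ : ℝ) - ⌊x⌋ = n * m := by exact_mod_cast hm
    have h4 := Int.floor_add_fract x
    have h5 := Int.floor_add_fract y
    simp only [zsmul_eq_mul]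
    linarith
  · rw [(Homeomorph.surjective _).range_comp]
    ext z
    constructor
    · rintro ⟨x, rfl⟩
      induction x using QuotientAddGroup.induction_on with | H x => ?_
      exact ⟨x, rfl⟩
    · rintro ⟨x, rfl⟩
      exact ⟨(x : AddCircle (n : ℝ)), rfl⟩

theorem exists_jordanCurves_of_perm [Finite B]
    (hinj : ∀ b b', ∀ t ∈ Ico (0 : ℝ) 1, ∀ t' ∈ Ico (0 : ℝ) 1,
      AffineMap.lineMap (p b) (p (σ b)) t = AffineMap.lineMap (p b') (p (σ b')) t' →
        b = b' ∧ t = t') :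
    ∃ 𝒥 : Set (Set ℂ), 𝒥.Finite ∧ (∀ J ∈ 𝒥, IsJordanCurve J) ∧
      𝒥.PairwiseDisjoint id ∧
        ⋃₀ 𝒥 = ⋃ b, AffineMap.lineMap (p b) (p (σ b)) '' Icc (0 : ℝ) 1 := by
  refine ⟨range fun b => range (polyLine σ p b), finite_range _, ?_, ?_, ?_⟩
  · rintro _ ⟨b, rfl⟩
    exact isJordanCurve_range_polyLine hinj b
  · rintro _ ⟨b, rfl⟩ _ ⟨b', rfl⟩ hne
    refine disjoint_left.2 ?_
    rintro _ ⟨x, rfl⟩ ⟨y, hxy⟩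
    simp only [polyLine, add_comm _ (1 : ℤ), zpow_add, zpow_one, Equiv.Perm.mul_apply] at hxy
    obtain ⟨h1, -⟩ := hinj _ _ _ ⟨Int.fract_nonneg y, Int.fract_lt_one y⟩ _
      ⟨Int.fract_nonneg x, Int.fract_lt_one x⟩ hxy
    refine hne ?_
    change range (polyLine σ p b) = range (polyLine σ p b')
    rw [← range_polyLine_zpow σ p b ⌊x⌋, ← range_polyLine_zpow σ p b' ⌊y⌋, h1]
  · rw [sUnion_range]
    ext z
    simp only [mem_iUnion]
    constructor
    · rintro ⟨b, x, rfl⟩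
      refine ⟨(σ ^ ⌊x⌋) b, Int.fract x, ⟨Int.fract_nonneg x, (Int.fract_lt_one x).le⟩, ?_⟩
      rw [polyLine, add_comm ⌊x⌋ 1, zpow_add, zpow_one, Equiv.Perm.mul_apply]
    · rintro ⟨b, t, ht, rfl⟩
      refine ⟨b, t, ?_⟩
      rw [polyLine_eq_of_mem_Icc σ p b 0 (by simpa using ht)]
      simp

end PolygonalCycles

/-! ### Boundary edges of a set of grid cells -/

/-- The directed unit edges of the square grid that have a cell of `S` on their left and a cell
outside `S` on their right. A cell is named by its lower left corner. -/
def BoundaryEdge (S : Set (ℤ × ℤ)) (v w : ℤ × ℤ) : Prop :=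
  (w = (v.1 + 1, v.2) ∧ (v.1, v.2) ∈ S ∧ (v.1, v.2 - 1) ∉ S) ∨
  (w = (v.1 - 1, v.2) ∧ (v.1 - 1, v.2 - 1) ∈ S ∧ (v.1 - 1, v.2) ∉ S) ∨
  (w = (v.1, v.2 + 1) ∧ (v.1 - 1, v.2) ∈ S ∧ (v.1, v.2) ∉ S) ∨
  (w = (v.1, v.2 - 1) ∧ (v.1, v.2 - 1) ∈ S ∧ (v.1 - 1, v.2 - 1) ∉ S)

/-- No four cells around a vertex form a checkerboard pattern. -/
def CheckerboardFree (S : Set (ℤ × ℤ)) : Prop :=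
  ∀ a b : ℤ,
    ¬ ((a, b) ∈ S ∧ (a - 1, b - 1) ∈ S ∧ (a - 1, b) ∉ S ∧ (a, b - 1) ∉ S) ∧
    ¬ ((a - 1, b) ∈ S ∧ (a, b - 1) ∈ S ∧ (a, b) ∉ S ∧ (a - 1, b - 1) ∉ S)

namespace BoundaryEdge

variable {S : Set (ℤ × ℤ)}

theorem right_unique (hS : CheckerboardFree S) {v w w' : ℤ × ℤ} (h : BoundaryEdge S v w)
    (h' : BoundaryEdge S v w') : w = w' := by
  obtain ⟨a, b⟩ := v
  have := hS a b
  unfold BoundaryEdge at h h'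
  rcases h with ⟨rfl, h⟩ | ⟨rfl, h⟩ | ⟨rfl, h⟩ | ⟨rfl, h⟩ <;>
  rcases h' with ⟨rfl, h'⟩ | ⟨rfl, h'⟩ | ⟨rfl, h'⟩ | ⟨rfl, h'⟩ <;> first | rfl | (exfalso; tauto)

/-- The edges that end at a vertex, in terms of the four cells around it. -/
theorem iff_incoming {v : ℤ × ℤ} {a b : ℤ} : BoundaryEdge S v (a, b) ↔
    (v = (a - 1, b) ∧ (a - 1, b) ∈ S ∧ (a - 1, b - 1) ∉ S) ∨
    (v = (a + 1, b) ∧ (a, b - 1) ∈ S ∧ (a, b) ∉ S) ∨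
    (v = (a, b - 1) ∧ (a - 1, b - 1) ∈ S ∧ (a, b - 1) ∉ S) ∨
    (v = (a, b + 1) ∧ (a, b) ∈ S ∧ (a - 1, b) ∉ S) := by
  obtain ⟨c, d⟩ := v
  unfold BoundaryEdge
  refine or_congr ?_ (or_congr ?_ (or_congr ?_ ?_)) <;>
  · simp only [Prod.mk.injEq]
    constructor <;> rintro ⟨⟨h1, h2⟩, h3⟩
    · refine ⟨⟨by omega, by omega⟩, ?_⟩
      subst h1 h2
      simpa using h3
    · refine ⟨⟨by omega, by omega⟩, ?_⟩
      subst h1 h2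
      simpa using h3

theorem left_unique (hS : CheckerboardFree S) {v v' w : ℤ × ℤ} (h : BoundaryEdge S v w)
    (h' : BoundaryEdge S v' w) : v = v' := by
  obtain ⟨a, b⟩ := w
  have := hS a b
  rw [iff_incoming] at h h'
  rcases h with ⟨rfl, h⟩ | ⟨rfl, h⟩ | ⟨rfl, h⟩ | ⟨rfl, h⟩ <;>
  rcases h' with ⟨rfl, h'⟩ | ⟨rfl, h'⟩ | ⟨rfl, h'⟩ | ⟨rfl, h'⟩ <;> first | rfl | (exfalso; tauto)

/-- Counterclockwise around a vertex, incoming edges mark passages out of `S` and outgoing edges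
passages into `S`; these alternate. -/
theorem exists_next {v w : ℤ × ℤ} (h : BoundaryEdge S v w) : ∃ u, BoundaryEdge S w u := by
  obtain ⟨a, b⟩ := w
  rw [iff_incoming] at h
  simp only [BoundaryEdge, exists_or, exists_eq_left]
  tauto

theorem not_symm {v w : ℤ × ℤ} (h : BoundaryEdge S v w) : ¬ BoundaryEdge S w v := by
  obtain ⟨a, b⟩ := w
  intro h'
  rw [iff_incoming] at h
  unfold BoundaryEdge at h'
  rcases h with ⟨rfl, h⟩ | ⟨rfl, h⟩ | ⟨rfl, h⟩ | ⟨rfl, h⟩ <;>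
  rcases h' with ⟨e, h'⟩ | ⟨e, h'⟩ | ⟨e, h'⟩ | ⟨e, h'⟩ <;>
  simp only [Prod.mk.injEq] at e <;> first | omega | tauto

end BoundaryEdge

/-- A point of the integer lattice as a complex number. -/
def latticePoint (v : ℤ × ℤ) : ℂ := ⟨v.1, v.2⟩

theorem lineMap_latticePoint_re (v w : ℤ × ℤ) (t : ℝ) :
    (AffineMap.lineMap (latticePoint v) (latticePoint w) t : ℂ).re = v.1 + t * (w.1 - v.1) := by
  simp [AffineMap.lineMap_apply, latticePoint]
  ring

theorem lineMap_latticePoint_im (v w : ℤ × ℤ) (t : ℝ) :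
    (AffineMap.lineMap (latticePoint v) (latticePoint w) t : ℂ).im = v.2 + t * (w.2 - v.2) := by
  simp [AffineMap.lineMap_apply, latticePoint]
  ring

/-- Distinct grid edges meet only at lattice points, which half-open edges attain only at their
start. The one other possible overlap, an edge and its reverse, is excluded by `not_symm`. -/
theorem BoundaryEdge.lineMap_inj {S : Set (ℤ × ℤ)} (hS : CheckerboardFree S)
    {v w v' w' : ℤ × ℤ} (h : BoundaryEdge S v w) (h' : BoundaryEdge S v' w') {t t' : ℝ}
    (ht : t ∈ Ico (0 : ℝ) 1) (ht' : t' ∈ Ico (0 : ℝ) 1)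
    (he : (AffineMap.lineMap (latticePoint v) (latticePoint w) t : ℂ) =
      AffineMap.lineMap (latticePoint v') (latticePoint w') t') : v = v' ∧ t = t' := by
  have hre := congrArg Complex.re he
  have him := congrArg Complex.im he
  rw [lineMap_latticePoint_re, lineMap_latticePoint_re] at hre
  rw [lineMap_latticePoint_im, lineMap_latticePoint_im] at him
  obtain ⟨ht0, ht1⟩ := ht
  obtain ⟨ht0', ht1'⟩ := ht'
  by_cases hv : v = v'
  · subst hv
    refine ⟨rfl, ?_⟩
    obtain rfl := h.right_unique hS h'
    rcases h with ⟨rfl, h⟩ | ⟨rfl, h⟩ | ⟨rfl, h⟩ | ⟨rfl, h⟩ <;> push_cast at hre him <;> linarith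
  · exfalso
    have hsymm : ¬ (v = w' ∧ w = v') := by
      rintro ⟨rfl, rfl⟩
      exact h.not_symm h'
    clear he
    obtain ⟨a, b⟩ := v
    obtain ⟨c, d⟩ := v'
    unfold BoundaryEdge at h h'
    have key : ∀ m n : ℤ, (m : ℝ) - n < 2 → (n : ℝ) - m < 2 → m = n - 1 ∨ m = n ∨ m = n + 1 := by
      intro m n h1 h2
      have h1' : m - n < 2 := by exact_mod_cast h1
      have h2' : n - m < 2 := by exact_mod_cast h2
      omega
    simp only [Prod.mk.injEq] at hv hsymm
    rcases h with ⟨rfl, -⟩ | ⟨rfl, -⟩ | ⟨rfl, -⟩ | ⟨rfl, -⟩ <;>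
    rcases h' with ⟨rfl, -⟩ | ⟨rfl, -⟩ | ⟨rfl, -⟩ | ⟨rfl, -⟩ <;>
    push_cast at hre him <;>
    rcases key a c (by linarith) (by linarith) with rfl | rfl | rfl <;>
    rcases key b d (by linarith) (by linarith) with rfl | rfl | rfl <;>
    push_cast at hre him <;>
    first
      | linarith
      | exact hv ⟨rfl, rfl⟩
      | exact hsymm (by simp)

theorem BoundaryEdge.finite {S : Set (ℤ × ℤ)} (hS : S.Finite) :
    {v | ∃ w, BoundaryEdge S v w}.Finite := by
  refine (((hS.union (hS.image fun c => (c.1 + 1, c.2 + 1))).union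
    (hS.image fun c => (c.1 + 1, c.2))).union (hS.image fun c => (c.1, c.2 + 1))).subset ?_
  rintro ⟨a, b⟩ ⟨w, h⟩
  rcases h with ⟨-, h, -⟩ | ⟨-, h, -⟩ | ⟨-, h, -⟩ | ⟨-, h, -⟩
  · exact Or.inl (Or.inl (Or.inl h))
  · exact Or.inl (Or.inl (Or.inr ⟨_, h, by simp⟩))
  · exact Or.inl (Or.inr ⟨_, h, by simp⟩)
  · exact Or.inr ⟨_, h, by simp⟩

theorem exists_jordanCurves_boundaryEdge {S : Set (ℤ × ℤ)} (hfin : S.Finite)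
    (hS : CheckerboardFree S) :
    ∃ 𝒥 : Set (Set ℂ), 𝒥.Finite ∧ (∀ J ∈ 𝒥, IsJordanCurve J) ∧
      𝒥.PairwiseDisjoint id ∧ ⋃₀ 𝒥 = {z | ∃ v w, BoundaryEdge S v w ∧
        z ∈ AffineMap.lineMap (latticePoint v) (latticePoint w) '' Icc (0 : ℝ) 1} := by
  let B := {v // ∃ w, BoundaryEdge S v w}
  have : Finite B := BoundaryEdge.finite hfin
  let next : B → B := fun b => ⟨b.2.choose, b.2.choose_spec.exists_next⟩
  have hnext : ∀ b : B, BoundaryEdge S b (next b) := fun b => b.2.choose_spec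
  have hinj : Function.Injective next := fun b b' h =>
    Subtype.ext ((hnext b).left_unique hS (h ▸ hnext b'))
  -- An injective self-map of a finite set is a permutation.
  let σ : Equiv.Perm B := Equiv.ofBijective next (Finite.injective_iff_bijective.1 hinj)
  obtain ⟨𝒥, h1, h2, h3, h4⟩ := exists_jordanCurves_of_perm (σ := σ)
    (p := fun b => latticePoint b) (fun b b' t ht t' ht' he =>
      ((hnext b).lineMap_inj hS (hnext b') ht ht' he).imp Subtype.ext id)
  refine ⟨𝒥, h1, h2, h3, h4.trans ?_⟩
  ext z
  simp only [mem_iUnion, mem_ofPred_eq]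
  constructor
  · rintro ⟨b, hz⟩
    exact ⟨b, next b, hnext b, hz⟩
  · rintro ⟨v, w, h, hz⟩
    rw [h.right_unique hS (hnext ⟨v, w, h⟩)] at hz
    exact ⟨⟨v, w, h⟩, hz⟩

/-! ### The frontier of a finite union of cells -/

/-- The closed unit square with lower left corner `c`. -/
def gridCell (c : ℤ × ℤ) : Set ℂ := Icc (c.1 : ℝ) (c.1 + 1) ×ℂ Icc (c.2 : ℝ) (c.2 + 1)

theorem mem_gridCell {c : ℤ × ℤ} {z : ℂ} : z ∈ gridCell c ↔
    ((c.1 : ℝ) ≤ z.re ∧ z.re ≤ c.1 + 1) ∧ ((c.2 : ℝ) ≤ z.im ∧ z.im ≤ c.2 + 1) := by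
  simp [gridCell, Complex.mem_reProdIm]

theorem mem_gridCell_floor (z : ℂ) : z ∈ gridCell (⌊z.re⌋, ⌊z.im⌋) :=
  mem_gridCell.2 ⟨⟨Int.floor_le _, (Int.lt_floor_add_one _).le⟩,
    Int.floor_le _, (Int.lt_floor_add_one _).le⟩

theorem isCompact_gridCell (c : ℤ × ℤ) : IsCompact (gridCell c) :=
  isCompact_Icc.reProdIm isCompact_Icc

theorem locallyFinite_gridCell : LocallyFinite gridCell := by
  intro z
  refine ⟨_, Metric.ball_mem_nhds z one_pos, ((finite_Icc (⌊z.re⌋ - 3) (⌊z.re⌋ + 3)).prod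
    (finite_Icc (⌊z.im⌋ - 3) (⌊z.im⌋ + 3))).subset ?_⟩
  rintro ⟨i, j⟩ ⟨y, hy, hyz⟩
  obtain ⟨⟨h1, h2⟩, h3, h4⟩ := mem_gridCell.1 hy
  rw [Metric.mem_ball, Complex.dist_eq] at hyz
  have h5 := abs_lt.1 ((Complex.abs_re_le_norm (y - z)).trans_lt hyz)
  have h6 := abs_lt.1 ((Complex.abs_im_le_norm (y - z)).trans_lt hyz)
  simp only [Complex.sub_re, Complex.sub_im] at h5 h6
  have h7 := Int.floor_le z.re
  have h8 := Int.lt_floor_add_one z.re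
  have h9 := Int.floor_le z.im
  have h10 := Int.lt_floor_add_one z.im
  have aux : ∀ (k l : ℤ), (k : ℝ) < l + 3 → (l : ℝ) < k + 3 → k ∈ Icc (l - 3) (l + 3) := by
    intro k l h h'
    have h1 : k < l + 3 := by exact_mod_cast h
    have h2 : l < k + 3 := by exact_mod_cast h'
    exact ⟨by omega, by omega⟩
  exact ⟨aux _ _ (by dsimp at *; linarith) (by dsimp at *; linarith),
    aux _ _ (by dsimp at *; linarith) (by dsimp at *; linarith)⟩

theorem isCompact_iUnion_gridCell {S : Set (ℤ × ℤ)} (hS : S.Finite) :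
    IsCompact (⋃ c ∈ S, gridCell c) := hS.isCompact_biUnion fun c _ => isCompact_gridCell c

/-- A point of an outer cell is a limit of points outside the union of the chosen cells. -/
theorem gridCell_subset_closure_compl {S : Set (ℤ × ℤ)} {c : ℤ × ℤ} (hc : c ∉ S) :
    gridCell c ⊆ closure (⋃ c ∈ S, gridCell c)ᶜ := by
  have : gridCell c = closure (Ioo (c.1 : ℝ) (c.1 + 1) ×ℂ Ioo (c.2 : ℝ) (c.2 + 1)) := by
    rw [Complex.closure_reProdIm, closure_Ioo (by linarith), closure_Ioo (by linarith), gridCell]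
  rw [this]
  refine closure_mono fun z hz hz' => ?_
  simp only [mem_iUnion] at hz'
  obtain ⟨d, hd, hzd⟩ := hz'
  obtain ⟨⟨h1, h2⟩, h3, h4⟩ := mem_gridCell.1 hzd
  obtain ⟨⟨h5, h6⟩, h7, h8⟩ := hz
  have aux : ∀ k l : ℤ, (k : ℝ) < l + 1 → (l : ℝ) < k + 1 → k = l := by
    intro k l h h'
    have h1 : k < l + 1 := by exact_mod_cast h
    have h2 : l < k + 1 := by exact_mod_cast h'
    omega
  refine hc ?_
  have : c = d := Prod.ext (aux _ _ (by linarith) (by linarith)) (aux _ _ (by linarith) (by linarith))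
  rwa [this]

/-- By local finiteness, near `z` there are only points of cells containing `z`; if all of these
were in `S`, then `z` would be interior. -/
theorem exists_notMem_of_mem_frontier {S : Set (ℤ × ℤ)} {z : ℂ}
    (hz : z ∈ frontier (⋃ c ∈ S, gridCell c)) : ∃ c ∉ S, z ∈ gridCell c := by
  by_contra! h
  refine hz.2 (mem_interior_iff_mem_nhds.2 ?_)
  filter_upwards [locallyFinite_gridCell.eventually_subset
    (fun c => (isCompact_gridCell c).isClosed) z] with w hw
  refine mem_biUnion ?_ (mem_gridCell_floor w)
  by_contra hc
  exact h _ hc (hw (mem_gridCell_floor w))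

theorem mem_lineMap_image_of_im_eq {v : ℤ × ℤ} {z : ℂ} (h : z.im = v.2) (h1 : (v.1 : ℝ) ≤ z.re)
    (h2 : z.re ≤ v.1 + 1) :
    z ∈ AffineMap.lineMap (latticePoint v) (latticePoint (v.1 + 1, v.2)) '' Icc (0 : ℝ) 1 := by
  refine ⟨z.re - v.1, ⟨by linarith, by linarith⟩, Complex.ext ?_ ?_⟩
  · rw [lineMap_latticePoint_re]; push_cast; ring
  · rw [lineMap_latticePoint_im, h]; push_cast; ring

theorem mem_lineMap_image_of_re_eq {v : ℤ × ℤ} {z : ℂ} (h : z.re = v.1) (h1 : (v.2 : ℝ) ≤ z.im)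
    (h2 : z.im ≤ v.2 + 1) :
    z ∈ AffineMap.lineMap (latticePoint v) (latticePoint (v.1, v.2 + 1)) '' Icc (0 : ℝ) 1 := by
  refine ⟨z.im - v.2, ⟨by linarith, by linarith⟩, Complex.ext ?_ ?_⟩
  · rw [lineMap_latticePoint_re, h]; push_cast; ring
  · rw [lineMap_latticePoint_im]; push_cast; ring

theorem lineMap_image_symm (x y : ℂ) :
    AffineMap.lineMap x y '' Icc (0 : ℝ) 1 = AffineMap.lineMap y x '' Icc (0 : ℝ) 1 := by
  rw [← segment_eq_image_lineMap, ← segment_eq_image_lineMap, segment_symm]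

theorem exists_boundaryEdge_of_re {S : Set (ℤ × ℤ)} {i i' j : ℤ} (h : (i, j) ∈ S)
    (h' : (i', j) ∉ S) {z : ℂ} (hz : z ∈ gridCell (i, j)) (hz' : z ∈ gridCell (i', j)) :
    ∃ v w, BoundaryEdge S v w ∧
      z ∈ AffineMap.lineMap (latticePoint v) (latticePoint w) '' Icc (0 : ℝ) 1 := by
  rw [mem_gridCell] at hz hz'
  dsimp only at hz hz'
  have h1 : i ≤ i' + 1 := by
    have : (i : ℝ) ≤ i' + 1 := by linarith
    exact_mod_cast this
  have h2 : i' ≤ i + 1 := by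
    have : (i' : ℝ) ≤ i + 1 := by linarith
    exact_mod_cast this
  obtain rfl | rfl | rfl : i' = i ∨ i' = i + 1 ∨ i = i' + 1 := by omega
  · exact absurd h h'
  · push_cast at hz'
    exact ⟨(i + 1, j), (i + 1, j + 1), Or.inr (Or.inr (Or.inl ⟨rfl, by simpa using h, h'⟩)),
      mem_lineMap_image_of_re_eq (v := (i + 1, j)) (by push_cast; linarith) hz.2.1 hz.2.2⟩
  · push_cast at hz
    refine ⟨(i' + 1, j + 1), (i' + 1, j), Or.inr (Or.inr (Or.inr
      ⟨by simp, by simpa using h, by simpa using h'⟩)), ?_⟩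
    rw [lineMap_image_symm]
    exact mem_lineMap_image_of_re_eq (v := (i' + 1, j)) (by push_cast; linarith) hz.2.1 hz.2.2

theorem exists_boundaryEdge_of_im {S : Set (ℤ × ℤ)} {i j j' : ℤ} (h : (i, j) ∈ S)
    (h' : (i, j') ∉ S) {z : ℂ} (hz : z ∈ gridCell (i, j)) (hz' : z ∈ gridCell (i, j')) :
    ∃ v w, BoundaryEdge S v w ∧
      z ∈ AffineMap.lineMap (latticePoint v) (latticePoint w) '' Icc (0 : ℝ) 1 := by
  rw [mem_gridCell] at hz hz'
  dsimp only at hz hz'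
  have h1 : j ≤ j' + 1 := by
    have : (j : ℝ) ≤ j' + 1 := by linarith
    exact_mod_cast this
  have h2 : j' ≤ j + 1 := by
    have : (j' : ℝ) ≤ j + 1 := by linarith
    exact_mod_cast this
  obtain rfl | rfl | rfl : j' = j ∨ j' = j + 1 ∨ j = j' + 1 := by omega
  · exact absurd h h'
  · push_cast at hz'
    refine ⟨(i + 1, j + 1), (i, j + 1), Or.inr (Or.inl
      ⟨by simp, by simpa using h, by simpa using h'⟩), ?_⟩
    rw [lineMap_image_symm]
    exact mem_lineMap_image_of_im_eq (v := (i, j + 1)) (by push_cast; linarith) hz.1.1 hz.1.2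
  · push_cast at hz
    exact ⟨(i, j' + 1), (i + 1, j' + 1), Or.inl ⟨rfl, h, by simpa using h'⟩,
      mem_lineMap_image_of_im_eq (v := (i, j' + 1)) (by push_cast; linarith) hz.1.1 hz.1.2⟩

theorem BoundaryEdge.exists_cells {S : Set (ℤ × ℤ)} {v w : ℤ × ℤ} (h : BoundaryEdge S v w) {z : ℂ}
    (hz : z ∈ AffineMap.lineMap (latticePoint v) (latticePoint w) '' Icc (0 : ℝ) 1) :
    (∃ c ∈ S, z ∈ gridCell c) ∧ ∃ c ∉ S, z ∈ gridCell c := by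
  obtain ⟨t, ⟨ht0, ht1⟩, rfl⟩ := hz
  obtain ⟨a, b⟩ := v
  rcases h with ⟨rfl, h, h'⟩ | ⟨rfl, h, h'⟩ | ⟨rfl, h, h'⟩ | ⟨rfl, h, h'⟩ <;>
  · refine ⟨⟨_, h, ?_⟩, _, h', ?_⟩ <;>
    · rw [mem_gridCell, lineMap_latticePoint_re, lineMap_latticePoint_im]
      push_cast
      exact ⟨⟨by linarith, by linarith⟩, by linarith, by linarith⟩

theorem hasJordanBoundary_iUnion_gridCell {S : Set (ℤ × ℤ)} (hfin : S.Finite)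
    (hS : CheckerboardFree S) : HasJordanBoundary (⋃ c ∈ S, gridCell c) := by
  obtain ⟨𝒥, h1, h2, h3, h4⟩ := exists_jordanCurves_boundaryEdge hfin hS
  refine ⟨𝒥, h1, h2, h3, h4 ▸ subset_antisymm (fun z hz => ?_) ?_⟩
  · have hzK := (isCompact_iUnion_gridCell hfin).isClosed.frontier_subset hz
    simp only [mem_iUnion] at hzK
    obtain ⟨⟨i, j⟩, hc, hzc⟩ := hzK
    obtain ⟨⟨i', j'⟩, hc', hzc'⟩ := exists_notMem_of_mem_frontier hz
    -- The cells may touch only diagonally. The intermediate cell `(i', j)` also contains `z`, and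
    -- membership in `S` changes on one of the two steps through it.
    have hz2 : z ∈ gridCell (i', j) :=
      mem_gridCell.2 ⟨(mem_gridCell.1 hzc').1, (mem_gridCell.1 hzc).2⟩
    by_cases h : (i', j) ∈ S
    · exact exists_boundaryEdge_of_im h hc' hz2 hzc'
    · exact exists_boundaryEdge_of_re hc h hzc hz2
  · rintro z ⟨v, w, h, hz⟩
    obtain ⟨⟨c, hc, hzc⟩, c', hc', hzc'⟩ := h.exists_cells hz
    rw [frontier_eq_closure_inter_closure]
    exact ⟨subset_closure (mem_biUnion hc hzc), gridCell_subset_closure_compl hc' hzc'⟩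

/-! ### The brick tiling -/

/-- The left end of the brick that contains the cell `c`, in the tiling of the plane by bricks of
size `2 × 1` whose rows are shifted alternately. -/
def brickLeft (c : ℤ × ℤ) : ℤ := c.1 - (c.1 - c.2) % 2

/-- The closed brick that contains the cell `c`. -/
def brick (c : ℤ × ℤ) : Set ℂ :=
  Icc (brickLeft c : ℝ) (brickLeft c + 2) ×ℂ Icc (c.2 : ℝ) (c.2 + 1)

theorem mem_brick {c : ℤ × ℤ} {z : ℂ} : z ∈ brick c ↔
    ((brickLeft c : ℝ) ≤ z.re ∧ z.re ≤ brickLeft c + 2) ∧ ((c.2 : ℝ) ≤ z.im ∧ z.im ≤ c.2 + 1) := by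
  simp [brick, Complex.mem_reProdIm]

theorem brickLeft_le (c : ℤ × ℤ) : brickLeft c ≤ c.1 := by
  unfold brickLeft
  omega

theorem le_brickLeft_add_one (c : ℤ × ℤ) : c.1 ≤ brickLeft c + 1 := by
  unfold brickLeft
  omega

theorem gridCell_subset_brick (c : ℤ × ℤ) : gridCell c ⊆ brick c := by
  intro z hz
  have h1 : (brickLeft c : ℝ) ≤ c.1 := by exact_mod_cast brickLeft_le c
  have h2 : (c.1 : ℝ) ≤ brickLeft c + 1 := by exact_mod_cast le_brickLeft_add_one c
  obtain ⟨⟨h3, h4⟩, h5⟩ := mem_gridCell.1 hz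
  exact mem_brick.2 ⟨⟨by linarith, by linarith⟩, h5⟩

theorem brick_eq_of_brickLeft_eq {c d : ℤ × ℤ} (h1 : brickLeft c = brickLeft d) (h2 : c.2 = d.2) :
    brick c = brick d := by
  rw [brick, brick, h1, h2]

theorem exists_gridCell_of_mem_brick {c : ℤ × ℤ} {z : ℂ} (hz : z ∈ brick c) :
    ∃ d, brick d = brick c ∧ z ∈ gridCell d := by
  obtain ⟨⟨h1, h2⟩, h3⟩ := mem_brick.1 hz
  rcases le_total z.re (brickLeft c + 1) with h | h
  · exact ⟨(brickLeft c, c.2), brick_eq_of_brickLeft_eq (by simp only [brickLeft]; omega) rfl,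
      mem_gridCell.2 ⟨⟨h1, h⟩, h3⟩⟩
  · exact ⟨(brickLeft c + 1, c.2), brick_eq_of_brickLeft_eq (by simp only [brickLeft]; omega) rfl,
      mem_gridCell.2 ⟨⟨by push_cast; exact h, by push_cast; linarith⟩, h3⟩⟩

theorem isConnected_brick (c : ℤ × ℤ) : IsConnected (brick c) := by
  have hne : (brick c).Nonempty := ⟨⟨brickLeft c, c.2⟩, mem_brick.2 (by simp)⟩
  have hconv : convexHull ℝ (brick c) = brick c := by
    rw [brick, Complex.convexHull_reProdIm, (convex_Icc _ _).convexHull_eq,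
      (convex_Icc _ _).convexHull_eq]
  exact (hconv ▸ convex_convexHull ℝ (brick c)).isConnected hne

theorem dist_le_three_of_mem_brick {c : ℤ × ℤ} {z w : ℂ} (hz : z ∈ brick c) (hw : w ∈ brick c) :
    dist z w ≤ 3 := by
  obtain ⟨⟨h1, h2⟩, h3, h4⟩ := mem_brick.1 hz
  obtain ⟨⟨h5, h6⟩, h7, h8⟩ := mem_brick.1 hw
  rw [Complex.dist_eq]
  refine (Complex.norm_le_abs_re_add_abs_im _).trans ?_
  have h9 : |(z - w).re| ≤ 2 := by
    rw [Complex.sub_re, abs_le]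
    exact ⟨by linarith, by linarith⟩
  have h10 : |(z - w).im| ≤ 1 := by
    rw [Complex.sub_im, abs_le]
    exact ⟨by linarith, by linarith⟩
  linarith

/-- The cells of the bricks that meet `C`. -/
def brickCells (C : Set ℂ) : Set (ℤ × ℤ) := {c | (brick c ∩ C).Nonempty}

/-- At each vertex, either the two lower or the two upper cells belong to one brick, depending on
the parity of `a - b`. They are chosen together, whereas a checkerboard would separate them. -/
theorem checkerboardFree_brickCells (C : Set ℂ) : CheckerboardFree (brickCells C) := by
  intro a b
  rcases Int.emod_two_eq_zero_or_one (a - b) with h | h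
  · have : brick (a, b - 1) = brick (a - 1, b - 1) :=
      brick_eq_of_brickLeft_eq (by simp only [brickLeft]; omega) rfl
    simp only [brickCells, mem_ofPred_eq, this]
    tauto
  · have : brick (a, b) = brick (a - 1, b) :=
      brick_eq_of_brickLeft_eq (by simp only [brickLeft]; omega) rfl
    simp only [brickCells, mem_ofPred_eq, this]
    tauto

theorem finite_brickCells {C : Set ℂ} (hC : Bornology.IsBounded C) : (brickCells C).Finite := by
  have hb : Bornology.IsBounded (Metric.cthickening 3 C) := hC.cthickening
  refine (locallyFinite_gridCell.finite_nonempty_inter_compact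
    (Metric.isCompact_of_isClosed_isBounded Metric.isClosed_cthickening hb)).subset ?_
  rintro c ⟨w, hw, hwC⟩
  have hc : latticePoint c ∈ gridCell c := mem_gridCell.2 (by simp [latticePoint])
  exact ⟨_, hc, Metric.mem_cthickening_of_dist_le _ w _ _ hwC
    (dist_le_three_of_mem_brick (gridCell_subset_brick c hc) hw)⟩

theorem iUnion_gridCell_brickCells (C : Set ℂ) :
    ⋃ c ∈ brickCells C, gridCell c = ⋃ c ∈ brickCells C, brick c := by
  refine subset_antisymm (iUnion₂_mono fun c _ => gridCell_subset_brick c) ?_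
  refine iUnion₂_subset fun c hc z hz => ?_
  obtain ⟨d, hd, hz⟩ := exists_gridCell_of_mem_brick hz
  refine mem_biUnion (?_ : (brick d ∩ C).Nonempty) hz
  rw [hd]
  exact hc

theorem subset_iUnion_gridCell_brickCells (C : Set ℂ) : C ⊆ ⋃ c ∈ brickCells C, gridCell c :=
  fun z hz => mem_biUnion
    (⟨z, gridCell_subset_brick _ (mem_gridCell_floor z), hz⟩ : (brick _ ∩ C).Nonempty)
    (mem_gridCell_floor z)

theorem isConnected_iUnion_gridCell_brickCells {C : Set ℂ} (hC : IsConnected C) :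
    IsConnected (⋃ c ∈ brickCells C, gridCell c) := by
  have hsub := subset_iUnion_gridCell_brickCells C
  obtain ⟨x, hx⟩ := hC.nonempty
  refine ⟨⟨x, hsub hx⟩, isPreconnected_of_forall x fun y hy => ?_⟩
  rw [iUnion_gridCell_brickCells] at hsub hy ⊢
  obtain ⟨c, hc, hyc⟩ := mem_iUnion₂.1 hy
  refine ⟨C ∪ brick c, union_subset hsub (subset_biUnion_of_mem (u := brick) hc), Or.inl hx,
    Or.inr hyc, ?_⟩
  obtain ⟨w, hw, hwC⟩ := hc
  exact hC.isPreconnected.union w hwC hw (isConnected_brick c).isPreconnected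

theorem exists_dist_le_three_of_mem_iUnion_gridCell {C : Set ℂ} {z : ℂ}
    (hz : z ∈ ⋃ c ∈ brickCells C, gridCell c) : ∃ w ∈ C, dist z w ≤ 3 := by
  obtain ⟨c, ⟨w, hw, hwC⟩, hz⟩ := mem_iUnion₂.1 hz
  exact ⟨w, hwC, dist_le_three_of_mem_brick (gridCell_subset_brick c hz) hw⟩

/-! ### Exhausting a domain by compact sets with Jordan boundary -/

theorem HasJordanBoundary.image_homeomorph {K : Set ℂ} (hK : HasJordanBoundary K) (φ : ℂ ≃ₜ ℂ) :
    HasJordanBoundary (φ '' K) := by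
  obtain ⟨𝒥, h1, h2, h3, h4⟩ := hK
  refine ⟨image φ '' 𝒥, h1.image _, ?_, ?_, ?_⟩
  · rintro _ ⟨J, hJ, rfl⟩
    obtain ⟨γ, hγ, hinj, rfl⟩ := h2 J hJ
    exact ⟨φ ∘ γ, φ.continuous.comp hγ, φ.injective.comp hinj, range_comp _ _⟩
  · rintro _ ⟨J, hJ, rfl⟩ _ ⟨J', hJ', rfl⟩ hne
    exact (disjoint_image_iff φ.injective).2 (h3 hJ hJ' fun h => hne (h ▸ rfl))
  · rw [← φ.image_frontier, h4, image_sUnion]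

/-- In a domain, each compact set lies in a connected compact set. -/
theorem exists_isCompact_isConnected_superset {G C : Set ℂ} (hG : IsOpen G) (hGc : IsConnected G)
    (hC : IsCompact C) (hCG : C ⊆ G) :
    ∃ K, IsCompact K ∧ IsConnected K ∧ K ⊆ G ∧ C ⊆ K := by
  obtain ⟨x₀, hx₀⟩ := hGc.nonempty
  have hpath := hG.isConnected_iff_isPathConnected.1 hGc
  -- `P` is a path from `x₀` to `x` together with a closed disc around `x`; finitely many such sets
  -- cover `C`, all sharing `x₀`.
  have key : ∀ x ∈ C, ∃ P, IsCompact P ∧ IsPreconnected P ∧ P ⊆ G ∧ x₀ ∈ P ∧ P ∈ 𝓝 x := by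
    intro x hx
    obtain ⟨r, hr, hrG⟩ := Metric.nhds_basis_closedBall.mem_iff.1 (hG.mem_nhds (hCG hx))
    obtain ⟨γ, hγ⟩ := hpath.joinedIn x₀ hx₀ x (hCG hx)
    refine ⟨range γ ∪ Metric.closedBall x r,
      (isCompact_range γ.continuous).union (isCompact_closedBall x r), ?_,
      union_subset (range_subset_iff.2 hγ) hrG, Or.inl ⟨0, γ.source⟩,
      Filter.mem_of_superset (Metric.closedBall_mem_nhds x hr) subset_union_right⟩
    exact (isPreconnected_range γ.continuous).union x ⟨1, γ.target⟩
      (Metric.mem_closedBall_self hr.le) (convex_closedBall x r).isPreconnected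
  choose! P h1 h2 h3 h4 h5 using key
  obtain ⟨t, ht, hCt⟩ := hC.elim_nhds_subcover P h5
  refine ⟨{x₀} ∪ ⋃ x ∈ t, P x, isCompact_singleton.union
    (t.isCompact_biUnion fun x hx => h1 x (ht x hx)), ⟨⟨x₀, Or.inl rfl⟩, ?_⟩,
    union_subset (singleton_subset_iff.2 hx₀) (iUnion₂_subset fun x hx => h3 x (ht x hx)),
    hCt.trans subset_union_right⟩
  refine isPreconnected_of_forall x₀ fun y hy => ?_
  rcases hy with rfl | hy
  · exact ⟨{y}, subset_union_left, rfl, rfl, isPreconnected_singleton⟩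
  · obtain ⟨x, hx, hyx⟩ := mem_iUnion₂.1 hy
    exact ⟨P x, (subset_biUnion_of_mem (u := P) hx).trans subset_union_right, h4 x (ht x hx), hyx,
      h2 x (ht x hx)⟩

/-- In a domain, each compact set lies in a connected compact set that is bounded by finitely many
pairwise disjoint Jordan curves. -/
theorem exists_hasJordanBoundary_superset {G C : Set ℂ} (hG : IsOpen G) (hGc : IsConnected G)
    (hC : IsCompact C) (hCG : C ⊆ G) :
    ∃ K, IsCompact K ∧ IsConnected K ∧ K ⊆ G ∧ HasJordanBoundary K ∧ C ⊆ K := by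
  obtain ⟨C', hC', hCc', hCG', hCC'⟩ := exists_isCompact_isConnected_superset hG hGc hC hCG
  obtain ⟨ε, hε, hεG⟩ := hC'.exists_cthickening_subset_open hG hCG'
  -- Bricks meeting `D` stay within distance `3` of it, so scaling by `ε / 3` keeps their images
  -- within `ε` of `C'`.
  have hδ : ε / 3 ≠ 0 := by positivity
  let φ : ℂ ≃ₜ ℂ := Homeomorph.smulOfNeZero (ε / 3) hδ
  have hφ : ∀ z w, dist (φ z) (φ w) = ε / 3 * dist z w := fun z w => by
    change dist ((ε / 3) • z) ((ε / 3) • w) = _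
    rw [dist_smul₀, Real.norm_of_nonneg (by positivity)]
  let D := φ.symm '' C'
  have hD : IsCompact D := hC'.image φ.symm.continuous
  have hDC : φ '' D = C' := by
    rw [← image_comp, φ.self_comp_symm, image_id]
  have hfin := finite_brickCells hD.isBounded
  refine ⟨φ '' ⋃ c ∈ brickCells D, gridCell c, (isCompact_iUnion_gridCell hfin).image φ.continuous,
    (isConnected_iUnion_gridCell_brickCells
      (hCc'.image _ φ.symm.continuous.continuousOn)).image _ φ.continuous.continuousOn, ?_,
    (hasJordanBoundary_iUnion_gridCell hfin (checkerboardFree_brickCells D)).image_homeomorph φ,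
    hCC'.trans (hDC ▸ image_mono (subset_iUnion_gridCell_brickCells D))⟩
  refine subset_trans ?_ hεG
  rintro _ ⟨z, hz, rfl⟩
  obtain ⟨w, hw, hzw⟩ := exists_dist_le_three_of_mem_iUnion_gridCell hz
  refine Metric.mem_cthickening_of_dist_le _ (φ w) _ _ (hDC ▸ mem_image_of_mem φ hw) ?_
  rw [hφ]
  nlinarith

theorem proposition2 (G F : Set ℂ) (hG_open : IsOpen G) (hG_conn : IsConnected G)
    (hFG : F ⊆ G) (hF : IsClosed {z : G | (z : ℂ) ∈ F}) :
    IsArakeljanSet G F ↔ IsTopologicalArakeljanSet G F := by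
  have hGF : IsOpen (G \ F) := by
    have h := hG_open.isOpenMap_subtype_val _ hF.isOpen_compl
    convert h using 1
    ext z
    simp [and_comm]
    tauto
  exact ⟨fun h => h.isTopologicalArakeljanSet hGF fun C hCG hC =>
    exists_hasJordanBoundary_superset hG_open hG_conn hC hCG, fun h => h.isArakeljanSet hGF⟩
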